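/- Let $\mathbb{F}$ be a field of characteristic $0$, $A$ an abelian group, $T$ a vector space over $\mathbb{F}$, and $\varphi : T\times A\to \mathbb{F}$ a map that is $\mathbb{F}$-linear in the first variable and additive in the second. Let $\mathbb{F}A$ be the group algebra of $A$ with basis $t^\alpha$ ($\alpha\in A$), and let $W=W(A,T,\varphi)$ be the generalized Witt algebra, that is, the vector space $\mathbb{F}A\otimes_{\mathbb{F}} T$ with the Lie bracket determined bilinearly by $$[t^\alpha\partial, t^\beta\partial'] = t^{\alpha+\beta}\bigl(\varphi(\partial,\beta)\partial'-\varphi(\partial',\alpha)\partial\bigr),\qquad \alpha,\beta\in A,\ \partial,\partial'\in T,$$ where $t^\alpha\partial$ denotes $t^\alpha\otimes\partial$. An automorphism of a Lie algebra $L$ is a bijective linear map $L\to L$ that preserves the bracket. A (not necessarily linear) map $\Phi:L\to L$ is a 2-local automorphism if for all $x,y\in L$ there is an automorphism $\theta_{x,y}$ of $L$ with $\Phi(x)=\theta_{x,y}(x)$ and $\Phi(y)=\theta_{x,y}(y)$. A linear map $\Phi:L\to L$ is a local automorphism if for every $x\in L$ there is an automorphism $\theta_x$ of $L$ with $\Phi(x)=\theta_x(x)$.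 Suppose that the Lie algebra $W(A,T,\varphi)$ is simple and that the group $A$ is finitely generated. Then $A\cong\mathbb{Z}^n$ for some positive integer $n$ with $\dim_{\mathbb{F}} T\le n$, and (a) every 2-local automorphism of $W(A,T,\varphi)$ is an automorphism; (b) every local automorphism of $W(A,T,\varphi)$ is an automorphism. In neither part is the map assumed to be invertible. -/

import Mathlib

open scoped TensorProduct

/-- The underlying space of the generalized Witt algebra `W(A, T, φ)`, namely `F[A] ⊗ T`, realised
as the space of finitely supported functions `A →₀ T`; the element `t^α ∂` is
`Finsupp.single α ∂`. The identification with the tensor product is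
`GeneralizedWitt.tensorEquiv`. The parameter `φ : T × A → F` is `F`-linear in the first and additive
in the second variable; it enters through the Lie bracket. -/
def GeneralizedWitt {F A T : Type*} [Field F] [AddCommGroup A] [AddCommGroup T] [Module F T]
    (_φ : T →ₗ[F] A →+ F) : Type _ :=
  A →₀ T

namespace GeneralizedWitt

noncomputable section

section Construction

variable {F A T : Type*} [Field F] [AddCommGroup A] [AddCommGroup T] [Module F T]
variable (φ : T →ₗ[F] A →+ F)

instance instAddCommGroup : AddCommGroup (GeneralizedWitt φ) :=
  inferInstanceAs (AddCommGroup (A →₀ T))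

instance instModule : Module F (GeneralizedWitt φ) :=
  inferInstanceAs (Module F (A →₀ T))

/-- The (identity) identification of `W(A, T, φ)` with finitely supported functions. -/
def toFinsupp : GeneralizedWitt φ ≃ₗ[F] (A →₀ T) :=
  LinearEquiv.refl F (A →₀ T)

/-- The element `t^α ∂`, as a linear function of `∂`. -/
def t (α : A) : T →ₗ[F] GeneralizedWitt φ :=
  (toFinsupp φ).symm.toLinearMap ∘ₗ Finsupp.lsingle α

theorem toFinsupp_t (α : A) (d : T) : toFinsupp φ (t φ α d) = Finsupp.single α d := by
  simp [t]

open scoped Classical in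
/-- The identification of the underlying space with `F[A] ⊗ T`. -/
def tensorEquiv : GeneralizedWitt φ ≃ₗ[F] (AddMonoidAlgebra F A ⊗[F] T) :=
  (toFinsupp φ).trans
    ((TensorProduct.congr (AddMonoidAlgebra.coeffLinearEquiv F) (LinearEquiv.refl F T)).trans
      (TensorProduct.finsuppScalarLeft F T A)).symm

theorem tensorEquiv_t (α : A) (d : T) :
    tensorEquiv φ (t φ α d) = AddMonoidAlgebra.single α (1 : F) ⊗ₜ[F] d := by
  rw [tensorEquiv, LinearEquiv.trans_apply, toFinsupp_t, LinearEquiv.symm_apply_eq]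
  simp [TensorProduct.finsuppScalarLeft_apply_tmul]

theorem induction_on {p : GeneralizedWitt φ → Prop} (x : GeneralizedWitt φ) (h0 : p 0)
    (hadd : ∀ x y, p x → p y → p (x + y)) (ht : ∀ α d, p (t φ α d)) : p x :=
  Finsupp.induction_linear (motive := p) x h0 hadd ht

/-- The linear map on `W(A, T, φ)` with prescribed values on the elements `t^α ∂`. -/
def lift {N : Type*} [AddCommGroup N] [Module F N] (f : A → T →ₗ[F] N) :
    GeneralizedWitt φ →ₗ[F] N :=
  Finsupp.lsum F f ∘ₗ (toFinsupp φ).toLinearMap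

theorem lift_t {N : Type*} [AddCommGroup N] [Module F N] (f : A → T →ₗ[F] N) (α : A) (d : T) :
    lift φ f (t φ α d) = f α d := by
  simp [lift, toFinsupp_t]

/-- The value `t^(α+β) (φ(∂, β) ∂' - φ(∂', α) ∂)` of the bracket `[t^α ∂, t^β ∂']`, as a bilinear
function of `∂` and `∂'`. -/
def bracketAux (α β : A) : T →ₗ[F] T →ₗ[F] GeneralizedWitt φ :=
  LinearMap.mk₂ F (fun d d' => t φ (α + β) (φ d β • d' - φ d' α • d))
    (fun d₁ d₂ d' => by
      rw [← map_add]; congr 1; simp only [map_add, AddMonoidHom.add_apply]; module)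
    (fun c d d' => by
      rw [← map_smul]; congr 1; simp only [map_smul, AddMonoidHom.smul_apply, smul_eq_mul]; module)
    (fun d d₁ d₂ => by
      rw [← map_add]; congr 1; simp only [map_add, AddMonoidHom.add_apply]; module)
    (fun c d d' => by
      rw [← map_smul]; congr 1; simp only [map_smul, AddMonoidHom.smul_apply, smul_eq_mul]; module)

/-- The bracket of `W(A, T, φ)`: the bilinear extension of `bracketAux`. -/
def bracket : GeneralizedWitt φ →ₗ[F] GeneralizedWitt φ →ₗ[F] GeneralizedWitt φ :=
  lift φ fun α => (lift φ fun β => (bracketAux φ α β).flip).flip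

theorem bracket_t_t (α β : A) (d d' : T) :
    bracket φ (t φ α d) (t φ β d') = t φ (α + β) (φ d β • d' - φ d' α • d) := by
  rw [bracket, lift_t, LinearMap.flip_apply, lift_t]
  rfl

theorem bracket_skew (x y : GeneralizedWitt φ) : bracket φ x y + bracket φ y x = 0 := by
  induction x using induction_on with
  | h0 => simp
  | hadd x₁ x₂ h₁ h₂ =>
    rw [map_add, map_add, LinearMap.add_apply, add_add_add_comm, h₁, h₂, add_zero]
  | ht α d =>
    induction y using induction_on with
    | h0 => simp
    | hadd y₁ y₂ h₁ h₂ =>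
      rw [map_add, map_add, LinearMap.add_apply, add_add_add_comm, h₁, h₂, add_zero]
    | ht β d' =>
      rw [bracket_t_t, bracket_t_t, add_comm β α, ← map_add]
      simp

theorem bracket_self (x : GeneralizedWitt φ) : bracket φ x x = 0 := by
  induction x using induction_on with
  | h0 => simp
  | hadd x y hx hy =>
    have h := bracket_skew φ x y
    simp only [map_add, LinearMap.add_apply, hx, hy, zero_add, add_zero]
    rwa [add_comm] at h
  | ht α d => rw [bracket_t_t, sub_self, map_zero]

theorem bracket_leibniz (x y z : GeneralizedWitt φ) :
    bracket φ x (bracket φ y z) =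
      bracket φ (bracket φ x y) z + bracket φ y (bracket φ x z) := by
  induction x using induction_on with
  | h0 => simp
  | hadd x₁ x₂ h₁ h₂ => simp only [map_add, LinearMap.add_apply, h₁, h₂]; abel
  | ht α d =>
    induction y using induction_on with
    | h0 => simp
    | hadd y₁ y₂ h₁ h₂ => simp only [map_add, LinearMap.add_apply, h₁, h₂]; abel
    | ht β e =>
      induction z using induction_on with
      | h0 => simp
      | hadd z₁ z₂ h₁ h₂ => simp only [map_add, h₁, h₂]; abel
      | ht γ f =>
        simp only [bracket_t_t]
        rw [← add_assoc α β γ, ← add_assoc β α γ, add_comm β α, ← map_add]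
        congr 1
        simp only [map_add, map_sub, map_smul, AddMonoidHom.sub_apply,
          AddMonoidHom.smul_apply, smul_eq_mul]
        module

instance instLieRing : LieRing (GeneralizedWitt φ) where
  bracket x y := bracket φ x y
  add_lie x y z := by
    change bracket φ (x + y) z = bracket φ x z + bracket φ y z
    rw [map_add, LinearMap.add_apply]
  lie_add x y z := (bracket φ x).map_add y z
  lie_self x := bracket_self φ x
  leibniz_lie x y z := bracket_leibniz φ x y z

instance instLieAlgebra : LieAlgebra F (GeneralizedWitt φ) where
  lie_smul c x y := (bracket φ x).map_smul c y

/-- The defining formula of the Lie bracket. -/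
theorem lie_t_t (α β : A) (d d' : T) :
    ⁅t φ α d, t φ β d'⁆ = t φ (α + β) (φ d β • d' - φ d' α • d) :=
  bracket_t_t φ α β d d'

end Construction

end

end GeneralizedWitt

/-- A map of a Lie algebra to itself is an automorphism if it is (the underlying map of) a
bijective linear map that preserves the bracket. -/
def IsLieAutomorphism (R : Type*) {L : Type*} [CommRing R] [LieRing L] [LieAlgebra R L]
    (Φ : L → L) : Prop :=
  ∃ θ : L ≃ₗ⁅R⁆ L, ∀ x, Φ x = θ x

/-- A (not necessarily linear) map is a 2-local automorphism if on any two elements it agrees with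
some automorphism. -/
def IsTwoLocalAutomorphism (R : Type*) {L : Type*} [CommRing R] [LieRing L] [LieAlgebra R L]
    (Φ : L → L) : Prop :=
  ∀ x y, ∃ θ : L ≃ₗ⁅R⁆ L, Φ x = θ x ∧ Φ y = θ y

/-- A linear map is a local automorphism if at any element it agrees with some automorphism. -/
def IsLocalAutomorphism {R L : Type*} [CommRing R] [LieRing L] [LieAlgebra R L]
    (Φ : L →ₗ[R] L) : Prop :=
  ∀ x, ∃ θ : L ≃ₗ⁅R⁆ L, Φ x = θ x

/-! Simplicity makes `φ` nondegenerate on both sides. In characteristic 0 this makes `A`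
torsion-free, hence free of finite rank n, and evaluation on a basis embeds `T` into F^n.

For both (a) and (b) the key is an element with trivial stabilizer in Aut W. The ad-locally finite
elements are exactly those of the torus t^0 T (`IsLocallyFinite.eq_t_zero`), so an automorphism
preserves the torus and permutes its weight spaces t^α T by an automorphism of `A`
(`exists_addEquiv`, `map_t`). If that permutation is trivial, t^α T is scaled by χ(α) for a
character χ (`exists_character`). Now sum t^(m b_i) d over a basis b, with two consecutive m for
each i and all m distinct. Divisibility forces a stabilizing automorphism to fix each degree m b_i,
hence all of `A`; then χ(m b_i) = χ((m+1) b_i) = 1 gives χ = 1 (`eq_id_of_fixes_rigidElement`).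

Part (a) follows: all automorphisms agreeing with Φ at this rigid x are equal. For (b), normalise to
Φ x = x. If a subset of `A` invariant under Aut A separates the degrees of x from those of y,
comparing Φ(y + x) with θ(y + x) gives Φ y = y (`local_fixes_of_separated`). A general y is reached
through a second rigid element, whose degrees are so divisible that it is separated from both x and
y. -/

namespace GeneralizedWitt

/-! ### Coefficients and supports -/

section Coefficients

variable {F A T : Type*} [Field F] [AddCommGroup A] [AddCommGroup T] [Module F T]
variable (φ : T →ₗ[F] A →+ F)

/-- The coefficient `∂` of `t^α` in an element of `W(A, T, φ)`. -/
noncomputable def coeff (α : A) : GeneralizedWitt φ →ₗ[F] T :=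
  Finsupp.lapply α ∘ₗ (toFinsupp φ).toLinearMap

theorem coeff_t_self (α : A) (d : T) : coeff φ α (t φ α d) = d := by
  simp [coeff, toFinsupp_t]

theorem coeff_t_of_ne {α β : A} (h : β ≠ α) (d : T) : coeff φ α (t φ β d) = 0 := by
  simp [coeff, toFinsupp_t, Finsupp.single_eq_of_ne' h]

variable {φ} in
theorem ext_coeff {x y : GeneralizedWitt φ} (h : ∀ α, coeff φ α x = coeff φ α y) : x = y :=
  (toFinsupp φ).injective (Finsupp.ext h)

/-- The support of an element of `W(A, T, φ)`. -/
noncomputable def supp (x : GeneralizedWitt φ) : Finset A :=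
  (toFinsupp φ x).support

theorem mem_supp {x : GeneralizedWitt φ} {α : A} : α ∈ supp φ x ↔ coeff φ α x ≠ 0 :=
  Finsupp.mem_support_iff

theorem eq_sum_t (x : GeneralizedWitt φ) : x = ∑ α ∈ supp φ x, t φ α (coeff φ α x) := by
  apply (toFinsupp φ).injective
  rw [map_sum]
  simp only [toFinsupp_t]
  exact (Finsupp.sum_single (toFinsupp φ x)).symm

theorem t_injective (α : A) : Function.Injective (t φ α) := fun d e h => by
  rw [← coeff_t_self φ α d, h, coeff_t_self]

theorem coeff_lie_t_zero (α : A) (d : T) (x : GeneralizedWitt φ) :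
    coeff φ α ⁅t φ 0 d, x⁆ = φ d α • coeff φ α x := by
  induction x using induction_on with
  | h0 => simp
  | hadd x y hx hy => simp only [lie_add, map_add, hx, hy, smul_add]
  | ht β e =>
    rw [lie_t_t, zero_add, map_zero, zero_smul, sub_zero]
    by_cases h : β = α
    · subst h; simp [coeff_t_self]
    · simp [coeff_t_of_ne φ h]

theorem lie_eq_sum (x y : GeneralizedWitt φ) :
    ⁅x, y⁆ = ∑ α ∈ supp φ x, ∑ β ∈ supp φ y,
      t φ (α + β) (φ (coeff φ α x) β • coeff φ β y - φ (coeff φ β y) α • coeff φ α x) := by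
  conv_lhs => rw [eq_sum_t φ x, eq_sum_t φ y]
  simp only [sum_lie, lie_sum, lie_t_t]
  exact Finset.sum_comm

end Coefficients

/-! ### Nondegeneracy of the pairing from simplicity -/

section Nondegenerate

variable {F A T : Type*} [Field F] [AddCommGroup A] [AddCommGroup T] [Module F T]
variable (φ : T →ₗ[F] A →+ F)

theorem isLieAbelian_of_eq_zero (h : ∀ d, φ d = 0) : IsLieAbelian (GeneralizedWitt φ) where
  trivial x y := by
    rw [lie_eq_sum]
    simp [h]

variable [LieAlgebra.IsSimple F (GeneralizedWitt φ)]

theorem exists_ne_zero : ∃ d, φ d ≠ 0 := by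
  by_contra! h
  exact LieAlgebra.IsSimple.non_abelian F (L := GeneralizedWitt φ) (isLieAbelian_of_eq_zero φ h)

/-- The ideal of elements with all coefficients in the left kernel of `φ`. -/
def leftKernelIdeal (φ : T →ₗ[F] A →+ F) : LieIdeal F (GeneralizedWitt φ) where
  carrier := {x | ∀ α, φ (coeff φ α x) = 0}
  add_mem' {x y} hx hy α := by rw [map_add, map_add, hx α, hy α, add_zero]
  zero_mem' α := by simp
  smul_mem' c x hx α := by rw [map_smul, map_smul, hx α, smul_zero]
  lie_mem {x y} hy γ := by
    rw [lie_eq_sum]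
    simp only [map_sum]
    refine Finset.sum_eq_zero fun α _ => Finset.sum_eq_zero fun β _ => ?_
    rw [hy β]
    by_cases h : α + β = γ
    · subst h
      rw [coeff_t_self]
      simp only [AddMonoidHom.zero_apply, zero_smul, sub_zero]
      rw [map_smul, hy β, smul_zero]
    · rw [coeff_t_of_ne φ h, map_zero]

/-- The left kernel spans an ideal, which is proper because `φ ≠ 0`: otherwise the algebra would be
abelian. -/
theorem left_nondegenerate {d : T} (h : φ d = 0) : d = 0 := by
  have key : ∀ e : T, φ e = 0 → t φ 0 e ∈ leftKernelIdeal φ := by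
    intro e he α
    by_cases h0 : (0 : A) = α
    · subst h0; rwa [coeff_t_self]
    · rw [coeff_t_of_ne φ h0, map_zero]
  rcases LieAlgebra.IsSimple.eq_bot_or_eq_top (R := F) (leftKernelIdeal φ) with hI | hI
  · have hd := key d h
    rw [hI, LieSubmodule.mem_bot] at hd
    exact t_injective φ 0 (hd.trans (map_zero _).symm)
  · obtain ⟨e, he⟩ := exists_ne_zero φ
    have h1 : t φ 0 e ∈ leftKernelIdeal φ := hI ▸ LieSubmodule.mem_top _
    have h2 := h1 0
    rw [coeff_t_self] at h2
    exact absurd h2 he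

/-- Multiplication by `t^γ` on `W(A, T, φ)`. -/
noncomputable def shift (φ : T →ₗ[F] A →+ F) (γ : A) : GeneralizedWitt φ →ₗ[F] GeneralizedWitt φ :=
  lift φ fun α => t φ (α + γ)

theorem lie_shift (φ : T →ₗ[F] A →+ F) {γ : A} (hγ : ∀ d, φ d γ = 0) (x y : GeneralizedWitt φ) :
    ⁅x, shift φ γ y⁆ = shift φ γ ⁅x, y⁆ := by
  induction x using induction_on with
  | h0 => simp
  | hadd x₁ x₂ h₁ h₂ => simp only [add_lie, map_add, h₁, h₂]
  | ht α d =>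
    induction y using induction_on with
    | h0 => simp
    | hadd y₁ y₂ h₁ h₂ => simp only [lie_add, map_add, h₁, h₂]
    | ht β e => simp only [shift, lift_t, lie_t_t, map_add, hγ, add_zero, add_assoc]

/-- The ideal `(t^γ - 1) W` for `γ` in the right kernel of `φ`. -/
noncomputable def shiftIdeal (φ : T →ₗ[F] A →+ F) {γ : A} (hγ : ∀ d, φ d γ = 0) :
    LieIdeal F (GeneralizedWitt φ) where
  __ := LinearMap.range (shift φ γ - LinearMap.id)
  lie_mem := by
    rintro x _ ⟨y, rfl⟩
    exact ⟨⁅x, y⁆, by simp [lie_shift φ hγ]⟩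

/-- Multiplication by t^γ commutes with all brackets, so (t^γ - 1) W is an ideal; it is nonzero if γ
≠ 0, and it is proper. -/
theorem right_nondegenerate {γ : A} (hγ : ∀ d, φ d γ = 0) : γ = 0 := by
  obtain ⟨e, he⟩ := exists_ne_zero φ
  by_contra h0
  rcases LieAlgebra.IsSimple.eq_bot_or_eq_top (R := F) (shiftIdeal φ hγ) with hI | hI
  · have h1 : shift φ γ (t φ 0 e) - t φ 0 e ∈ shiftIdeal φ hγ := ⟨t φ 0 e, rfl⟩
    rw [hI, LieSubmodule.mem_bot, shift, lift_t, zero_add] at h1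
    have h2 := congrArg (coeff φ 0) h1
    rw [map_sub, coeff_t_self, coeff_t_of_ne φ h0, map_zero, zero_sub, neg_eq_zero] at h2
    exact he (by rw [h2, map_zero])
  · have h1 : t φ 0 e ∈ shiftIdeal φ hγ := hI ▸ LieSubmodule.mem_top _
    obtain ⟨y, hy⟩ := h1
    -- The sum of all coefficients vanishes on (t^γ - 1) W, but not on t^0 e.
    have h2 : ∀ z, lift φ (fun _ => LinearMap.id) ((shift φ γ - LinearMap.id : _ →ₗ[F] _) z) = 0 := by
      intro z
      induction z using induction_on with
      | h0 => simp
      | hadd x y hx hy => rw [map_add, map_add, hx, hy, add_zero]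
      | ht α d => simp [shift, lift_t]
    have h3 := h2 y
    rw [hy, lift_t] at h3
    exact he (by rw [show e = 0 from h3, map_zero])

theorem eq_of_forall_apply_eq {α β : A} (h : ∀ d, φ d α = φ d β) : α = β :=
  sub_eq_zero.1 (right_nondegenerate φ fun d => by rw [map_sub, h, sub_self])

theorem eq_zero_of_zsmul_eq_zero [CharZero F] (φ : T →ₗ[F] A →+ F)
    [LieAlgebra.IsSimple F (GeneralizedWitt φ)] {m : ℤ} (hm : m ≠ 0) {α : A} (h : m • α = 0) : α = 0 := by
  refine right_nondegenerate φ fun d => ?_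
  have h1 : φ d (m • α) = 0 := by rw [h, map_zero]
  rw [map_zsmul, zsmul_eq_mul] at h1
  exact (mul_eq_zero.1 h1).resolve_left (Int.cast_ne_zero.2 hm)

theorem isTorsionFree_int [CharZero F] (φ : T →ₗ[F] A →+ F)
    [LieAlgebra.IsSimple F (GeneralizedWitt φ)] : Module.IsTorsionFree ℤ A :=
  Module.isTorsionFree_iff_smul_eq_zero.2 fun m α h => by
    by_cases hm : m = 0
    · exact Or.inl hm
    · exact Or.inr (eq_zero_of_zsmul_eq_zero φ hm h)

/-- Evaluation of `φ` on a basis of `A`. -/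
theorem basisEval_injective {ι : Type*} (b : Module.Basis ι ℤ A) :
    Function.Injective (LinearMap.pi fun i =>
      ({ toFun := fun d => φ d (b i), map_add' := by simp, map_smul' := by simp } : T →ₗ[F] F)) := by
  rw [← LinearMap.ker_eq_bot, LinearMap.ker_eq_bot']
  intro d hd
  refine left_nondegenerate φ ?_
  have : (φ d).toIntLinearMap = 0 := b.ext fun i => congrFun hd i
  ext α
  exact LinearMap.congr_fun this α

end Nondegenerate

end GeneralizedWitt

namespace GeneralizedWitt

/-! ### Ad-locally finite elements -/

section LocallyFinite

variable {F A T : Type*} [Field F] [AddCommGroup A] [AddCommGroup T] [Module F T]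
variable (φ : T →ₗ[F] A →+ F)

variable {φ} in
/-- An element is ad-locally finite if every element lies in a finite-dimensional subspace that is
stable under its adjoint action. -/
def IsLocallyFinite (x : GeneralizedWitt φ) : Prop :=
  ∀ y, ∃ V : Submodule F (GeneralizedWitt φ), V.FG ∧ y ∈ V ∧ ∀ v ∈ V, ⁅x, v⁆ ∈ V

variable {φ} in
theorem IsLocallyFinite.map {x : GeneralizedWitt φ} (hx : IsLocallyFinite x)
    (θ : GeneralizedWitt φ ≃ₗ⁅F⁆ GeneralizedWitt φ) : IsLocallyFinite (θ x) := by
  intro y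
  obtain ⟨V, hV, hy, hs⟩ := hx (θ.symm y)
  refine ⟨V.map (θ : GeneralizedWitt φ →ₗ[F] GeneralizedWitt φ), hV.map _,
    ⟨_, hy, θ.apply_symm_apply y⟩, ?_⟩
  rintro _ ⟨v, hv, rfl⟩
  exact ⟨_, hs v hv, θ.map_lie x v⟩

theorem isLocallyFinite_t_zero (d : T) : IsLocallyFinite (t φ 0 d) := by
  intro y
  refine ⟨Submodule.span F ((fun α => t φ α (coeff φ α y)) '' supp φ y),
    Submodule.fg_span ((supp φ y).finite_toSet.image _), ?_, ?_⟩
  · have h : ∑ α ∈ supp φ y, t φ α (coeff φ α y) ∈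
        Submodule.span F ((fun α => t φ α (coeff φ α y)) '' supp φ y) :=
      Submodule.sum_mem _ fun α hα => Submodule.subset_span ⟨α, hα, rfl⟩
    rwa [← eq_sum_t] at h
  · intro v hv
    induction hv using Submodule.span_induction with
    | mem v hv =>
      obtain ⟨α, hα, rfl⟩ := hv
      have : ⁅t φ 0 d, t φ α (coeff φ α y)⁆ = φ d α • t φ α (coeff φ α y) := by
        rw [lie_t_t, zero_add, map_zero, zero_smul, sub_zero, map_smul]
      dsimp only
      rw [this]
      exact Submodule.smul_mem _ _ (Submodule.subset_span ⟨α, hα, rfl⟩)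
    | zero => simp
    | add v w _ _ hv hw => rw [lie_add]; exact add_mem hv hw
    | smul c v _ hv => rw [lie_smul]; exact Submodule.smul_mem _ c hv

variable {φ} in
theorem exists_supp_subset {V : Submodule F (GeneralizedWitt φ)} (hV : V.FG) :
    ∃ S : Finset A, ∀ v ∈ V, ∀ α, coeff φ α v ≠ 0 → α ∈ S := by
  classical
  obtain ⟨s, rfl⟩ := hV
  refine ⟨s.biUnion (supp φ), fun v hv α => ?_⟩
  contrapose!
  intro hα
  induction hv using Submodule.span_induction with
  | mem v hv =>
    by_contra h
    exact hα (Finset.mem_biUnion.2 ⟨v, hv, (mem_supp φ).2 h⟩)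
  | zero => simp
  | add v w _ _ hv hw => rw [map_add, hv, hw, add_zero]
  | smul c v _ hv => rw [map_smul, hv, smul_zero]

section Leading

variable {Γ : Type*} [AddCommGroup Γ] [LinearOrder Γ] [IsOrderedAddMonoid Γ]
variable {ι : A →+ Γ}

variable {φ} in
/-- `t^a d` is the leading term of `x` with respect to the order on `A` pulled back along `ι`
(where `d` may vanish). -/
def IsLeading (ι : A →+ Γ) (x : GeneralizedWitt φ) (a : A) (d : T) : Prop :=
  (∀ γ, coeff φ γ x ≠ 0 → ι γ ≤ ι a) ∧ coeff φ a x = d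

variable {φ} in
-- In an ordered group the top degree a + b arises only from the pair (a, b), so nothing else
-- contributes to that coefficient.
theorem IsLeading.lie (hι : Function.Injective ι) {x y : GeneralizedWitt φ} {a b : A} {d e : T}
    (hx : IsLeading ι x a d)
    (hy : IsLeading ι y b e) : IsLeading ι ⁅x, y⁆ (a + b) (φ d b • e - φ e a • d) := by
  obtain ⟨hx, rfl⟩ := hx
  obtain ⟨hy, rfl⟩ := hy
  constructor
  · intro γ
    contrapose!
    intro hγ
    rw [lie_eq_sum, map_sum]
    refine Finset.sum_eq_zero fun α hα => ?_
    rw [map_sum]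
    refine Finset.sum_eq_zero fun β hβ => coeff_t_of_ne φ ?_ _
    rintro rfl
    rw [map_add, map_add] at hγ
    exact absurd (add_le_add (hx α ((mem_supp φ).1 hα)) (hy β ((mem_supp φ).1 hβ))) hγ.not_ge
  · rw [lie_eq_sum, map_sum, Finset.sum_eq_single a, map_sum, Finset.sum_eq_single b, coeff_t_self]
    · intro β _ hβ
      exact coeff_t_of_ne φ (by simpa using hβ) _
    · intro hb
      rw [mem_supp, not_not] at hb
      simp [hb]
    · intro α hα hne
      rw [map_sum]
      refine Finset.sum_eq_zero fun β hβ => coeff_t_of_ne φ (fun h => hne ?_) _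
      have h1 := hx α ((mem_supp φ).1 hα)
      have h2 := hy β ((mem_supp φ).1 hβ)
      have h3 : ι α + ι β = ι a + ι b := by rw [← map_add, h, map_add]
      exact hι (((add_eq_add_iff_eq_and_eq h1 h2).1 h3).1)
    · intro ha
      rw [mem_supp, not_not] at ha
      simp [ha]

variable [CharZero F] [LieAlgebra.IsSimple F (GeneralizedWitt φ)]

variable {φ} in
-- If the top degree a were positive, iterating ad x on t^b d for suitable b would give leading
-- degrees b + k a, infinitely many as `A` is torsion-free. A finite-dimensional subspace involves
-- only finitely many degrees.
theorem IsLocallyFinite.map_le_zero (hι : Function.Injective ι) {x : GeneralizedWitt φ}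
    (hx : IsLocallyFinite x) {α : A} (hα : coeff φ α x ≠ 0) : ι α ≤ 0 := by
  obtain ⟨a, ha, hmax⟩ := (supp φ x).exists_max_image ι ⟨α, (mem_supp φ).2 hα⟩
  refine (hmax α ((mem_supp φ).2 hα)).trans ?_
  by_contra hpos
  have ha0 : a ≠ 0 := by rintro rfl; simp at hpos
  set d := coeff φ a x with hd
  have hd0 : d ≠ 0 := (mem_supp φ).1 ha
  have hlead : IsLeading ι x a d := ⟨fun γ hγ => hmax γ ((mem_supp φ).2 hγ), rfl⟩
  -- These are the factors gained by the leading coefficient at each bracket. If φ d a = 0 they do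
  -- not depend on k; otherwise b = 2a turns them into (k + 1) φ d a.
  obtain ⟨b, hb⟩ : ∃ b, ∀ k : ℕ, φ d (b + k • a - a) ≠ 0 := by
    by_cases h : φ d a = 0
    · obtain ⟨b, hb⟩ : ∃ b, φ d b ≠ 0 := by
        by_contra! hb
        exact hd0 (left_nondegenerate φ (AddMonoidHom.ext hb))
      exact ⟨b, fun k => by simpa [h] using hb⟩
    · refine ⟨2 • a, fun k => ?_⟩
      have : φ d (2 • a + k • a - a) = ((k + 1 : ℕ) : F) * φ d a := by
        simp only [map_sub, map_add, map_nsmul, nsmul_eq_mul]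
        push_cast
        ring
      rw [this]
      exact mul_ne_zero (Nat.cast_ne_zero.2 k.succ_ne_zero) h
  obtain ⟨V, hV, hy, hs⟩ := hx (t φ b d)
  have key : ∀ k : ℕ, ∃ v ∈ V, ∃ c : F, c ≠ 0 ∧ IsLeading ι v (b + k • a) (c • d) := by
    intro k
    induction k with
    | zero =>
      refine ⟨_, hy, 1, one_ne_zero, fun γ hγ => ?_, by simp [coeff_t_self]⟩
      by_cases h : b = γ
      · simp [h]
      · exact absurd (coeff_t_of_ne φ h d) hγ
    | succ k ih =>
      obtain ⟨v, hv, c, hc, hl⟩ := ih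
      refine ⟨_, hs v hv, c * φ d (b + k • a - a), mul_ne_zero hc (hb k), ?_⟩
      have := hlead.lie hι hl
      convert this using 1
      · rw [succ_nsmul]; abel
      · rw [map_smul, AddMonoidHom.smul_apply, map_sub, smul_eq_mul]
        module
  obtain ⟨S, hS⟩ := exists_supp_subset hV
  have hmem : ∀ k : ℕ, b + k • a ∈ S := fun k => by
    obtain ⟨v, hv, c, hc, -, hl⟩ := key k
    exact hS v hv _ (by rw [hl]; exact smul_ne_zero hc hd0)
  refine Set.infinite_of_injective_forall_mem (f := fun k : ℕ => b + k • a) ?_ hmem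
    S.finite_toSet
  intro k l hkl
  have h1 : ((k : ℤ) - l) • a = 0 := by
    rw [sub_smul, natCast_zsmul, natCast_zsmul, sub_eq_zero]
    exact add_left_cancel hkl
  by_contra hne
  exact ha0 (eq_zero_of_zsmul_eq_zero φ (sub_ne_zero.2 (by exact_mod_cast hne)) h1)

variable {φ} in
theorem IsLocallyFinite.eq_t_zero (hι : Function.Injective ι) {x : GeneralizedWitt φ}
    (hx : IsLocallyFinite x) :
    x = t φ 0 (coeff φ 0 x) := by
  refine ext_coeff fun α => ?_
  by_cases h : 0 = α
  · subst h; rw [coeff_t_self]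
  rw [coeff_t_of_ne φ h]
  by_contra hα
  have h1 := hx.map_le_zero hι hα
  -- The same bound for the reversed order.
  have h2 := hx.map_le_zero (ι := -ι) (fun α β h => hι (neg_injective h)) hα
  rw [AddMonoidHom.neg_apply, neg_nonpos] at h2
  exact h (hι (by rw [map_zero, le_antisymm h1 h2]))

end Leading

theorem exists_injective_lex [Module.Finite ℤ A] [Module.Free ℤ A] :
    ∃ (n : ℕ) (ι : A →+ Lex (Fin n → ℤ)), Function.Injective ι :=
  ⟨_, ((Module.finBasis ℤ A).equivFun.toAddEquiv.trans
    (toLexAddEquiv _)).toAddMonoidHom, AddEquiv.injective _⟩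

end LocallyFinite

end GeneralizedWitt

namespace GeneralizedWitt

/-! ### Automorphisms permute the weight spaces -/

section Graded

variable {F A T : Type*} [Field F] [AddCommGroup A] [AddCommGroup T] [Module F T]
variable (φ : T →ₗ[F] A →+ F)
variable (θ : GeneralizedWitt φ ≃ₗ⁅F⁆ GeneralizedWitt φ)

/-- The action of an automorphism on the coefficients of degree zero. -/
noncomputable def torusMap : T →ₗ[F] T :=
  coeff φ 0 ∘ₗ (θ : GeneralizedWitt φ →ₗ[F] GeneralizedWitt φ) ∘ₗ t φ 0

theorem torusMap_apply (d : T) : torusMap φ θ d = coeff φ 0 (θ (t φ 0 d)) := rfl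

variable [CharZero F] [LieAlgebra.IsSimple F (GeneralizedWitt φ)]
variable [Module.Finite ℤ A]

theorem map_t_zero (d : T) : θ (t φ 0 d) = t φ 0 (torusMap φ θ d) := by
  have := isTorsionFree_int φ
  obtain ⟨n, ι, hι⟩ := exists_injective_lex (A := A)
  exact ((isLocallyFinite_t_zero φ d).map θ).eq_t_zero hι

theorem torusMap_symm_torusMap (d : T) : torusMap φ θ.symm (torusMap φ θ d) = d := by
  rw [torusMap_apply φ θ.symm, ← map_t_zero, LieEquiv.symm_apply_apply, coeff_t_self]

theorem torusMap_torusMap_symm (d : T) : torusMap φ θ (torusMap φ θ.symm d) = d := by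
  rw [torusMap_apply φ θ, ← map_t_zero, LieEquiv.apply_symm_apply, coeff_t_self]

variable {φ θ} in
-- The image of a weight vector is a weight vector for the transported torus action; the weight is
-- read off at any degree that occurs.
theorem apply_torusMap_of_coeff_ne_zero {α β : A} {d : T} (h : coeff φ β (θ (t φ α d)) ≠ 0)
    (e : T) : φ (torusMap φ θ e) β = φ e α := by
  have h1 := coeff_lie_t_zero φ β (torusMap φ θ e) (θ (t φ α d))
  rw [← map_t_zero, ← LieEquiv.map_lie, lie_t_t, zero_add, map_zero, zero_smul, sub_zero,
    map_smul, map_smul, map_smul] at h1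
  exact (smul_left_injective F h h1).symm

variable {φ θ} in
theorem eq_of_apply_torusMap {β β' : A} (h : ∀ e, φ (torusMap φ θ e) β = φ (torusMap φ θ e) β') :
    β = β' :=
  eq_of_forall_apply_eq φ fun d => by
    rw [← torusMap_torusMap_symm φ θ d]
    exact h _

theorem exists_apply_torusMap (α : A) : ∃ β, ∀ e, φ (torusMap φ θ e) β = φ e α := by
  obtain ⟨d, hd⟩ := exists_ne_zero φ
  have h0 : θ (t φ α d) ≠ 0 := by
    intro h
    have h1 : t φ α d = 0 := θ.injective (h.trans (map_zero θ).symm)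
    have h2 : d = 0 := t_injective φ α (h1.trans (map_zero _).symm)
    exact hd (by rw [h2, map_zero])
  obtain ⟨β, hβ⟩ : ∃ β, coeff φ β (θ (t φ α d)) ≠ 0 := by
    by_contra! h
    exact h0 (ext_coeff fun β => by rw [h, map_zero])
  exact ⟨β, apply_torusMap_of_coeff_ne_zero hβ⟩

/-- An automorphism permutes the degrees by an automorphism of the group `A`. -/
theorem exists_addEquiv : ∃ σ : A ≃+ A, ∀ α e, φ (torusMap φ θ e) (σ α) = φ e α := by
  choose f hf using exists_apply_torusMap φ θ
  choose g hg using exists_apply_torusMap φ θ.symm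
  refine ⟨{ toFun := f, invFun := g, left_inv := fun α => ?_, right_inv := fun α => ?_,
            map_add' := fun α β => ?_ }, hf⟩
  · refine eq_of_forall_apply_eq φ fun d => ?_
    rw [← torusMap_symm_torusMap φ θ d, hg, hf, torusMap_symm_torusMap]
  · refine eq_of_forall_apply_eq φ fun d => ?_
    rw [← torusMap_torusMap_symm φ θ d, hf, hg, torusMap_torusMap_symm]
  · refine eq_of_apply_torusMap (θ := θ) fun e => ?_
    rw [map_add, hf, hf, hf, map_add]

/-- The automorphism of `A` by which an automorphism of `W(A, T, φ)` permutes the degrees. -/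
noncomputable def degreeEquiv : A ≃+ A :=
  (exists_addEquiv φ θ).choose

theorem apply_torusMap_degreeEquiv (α : A) (e : T) :
    φ (torusMap φ θ e) (degreeEquiv φ θ α) = φ e α :=
  (exists_addEquiv φ θ).choose_spec α e

/-- The action of an automorphism on the coefficients of degree `α`. -/
noncomputable def coeffMap (α : A) : T →ₗ[F] T :=
  coeff φ (degreeEquiv φ θ α) ∘ₗ (θ : GeneralizedWitt φ →ₗ[F] GeneralizedWitt φ) ∘ₗ t φ α

theorem map_t (α : A) (d : T) : θ (t φ α d) = t φ (degreeEquiv φ θ α) (coeffMap φ θ α d) := by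
  refine ext_coeff fun β => ?_
  by_cases h : degreeEquiv φ θ α = β
  · subst h; rw [coeff_t_self]; rfl
  · rw [coeff_t_of_ne φ h]
    by_contra hne
    refine h (eq_of_apply_torusMap (θ := θ) fun e => ?_)
    rw [apply_torusMap_degreeEquiv, apply_torusMap_of_coeff_ne_zero hne]

theorem coeff_degreeEquiv (α : A) (x : GeneralizedWitt φ) :
    coeff φ (degreeEquiv φ θ α) (θ x) = coeffMap φ θ α (coeff φ α x) := by
  induction x using induction_on with
  | h0 => simp
  | hadd x y hx hy => simp only [map_add, hx, hy]
  | ht β d =>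
    rw [map_t]
    by_cases h : β = α
    · subst h; rw [coeff_t_self, coeff_t_self]
    · rw [coeff_t_of_ne φ h, coeff_t_of_ne φ (fun h' => h ((degreeEquiv φ θ).injective h')),
        map_zero]

theorem coeffMap_injective (α : A) : Function.Injective (coeffMap φ θ α) := fun d e h =>
  t_injective φ α (θ.injective ((map_t φ θ α d).trans
    ((congrArg _ h).trans (map_t φ θ α e).symm)))

theorem coeffMap_surjective (α : A) : Function.Surjective (coeffMap φ θ α) := fun d => by
  refine ⟨coeff φ α (θ.symm (t φ (degreeEquiv φ θ α) d)), ?_⟩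
  rw [← coeff_degreeEquiv, LieEquiv.apply_symm_apply, coeff_t_self]

variable {θ} in
theorem torusMap_of_degreeEquiv (h : ∀ α, degreeEquiv φ θ α = α) (d : T) : torusMap φ θ d = d := by
  rw [← sub_eq_zero]
  refine left_nondegenerate φ (AddMonoidHom.ext fun α => ?_)
  rw [map_sub, AddMonoidHom.sub_apply, ← apply_torusMap_degreeEquiv φ θ α d, h]
  simp

end Graded

/-! ### A trace criterion for proportionality -/

section Scalar

variable {F A T : Type*} [Field F] [AddCommGroup A] [AddCommGroup T] [Module F T]
variable (φ : T →ₗ[F] A →+ F)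

/-- Evaluation of `φ` at an element of `A`, as a linear form on `T`. -/
def evalForm (α : A) : T →ₗ[F] F where
  toFun d := φ d α
  map_add' := by simp
  map_smul' := by simp

theorem evalForm_apply (α : A) (d : T) : evalForm φ α d = φ d α := rfl

/-- The coefficient of `[t^(-α) v, [t^α u, t^β d]]`, as a linear function of `d`. -/
noncomputable def doubleBracket (α β : A) (u v : T) : T →ₗ[F] T :=
  (φ v (β + α) * φ u β) • LinearMap.id +
    (evalForm φ α).smulRight (φ u β • v - φ v (β + α) • u - φ u α • v)

theorem lie_lie_t (α β : A) (u v d : T) :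
    ⁅t φ (-α) v, ⁅t φ α u, t φ β d⁆⁆ = t φ β (doubleBracket φ α β u v d) := by
  rw [lie_t_t, lie_t_t, neg_add_cancel_left]
  congr 1
  simp only [doubleBracket, LinearMap.add_apply, LinearMap.smul_apply, LinearMap.id_apply,
    LinearMap.smulRight_apply, evalForm_apply, map_sub, map_smul, map_neg, map_add,
    AddMonoidHom.sub_apply, AddMonoidHom.smul_apply, smul_eq_mul]
  module

theorem trace_doubleBracket [Module.Finite F T] (α β : A) (u v : T) :
    LinearMap.trace F T (doubleBracket φ α β u v) =
      φ v (β + α) * φ u β * (Module.finrank F T : F) +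
        (φ u β * φ v α - φ v (β + α) * φ u α - φ u α * φ v α) := by
  rw [doubleBracket, map_add, map_smul, LinearMap.trace_id, LinearMap.trace_smulRight]
  simp only [evalForm_apply, map_sub, map_smul, smul_eq_mul]

/-- If the maps `[t^(-α) v, [t^α u, -]]` and `[t^(-α) d, [t^α d, -]]` have the same trace in each
degree, then `u` is a multiple of `d`. -/
theorem exists_eq_smul_of_trace_eq [CharZero F] [LieAlgebra.IsSimple F (GeneralizedWitt φ)] [Module.Finite F T]
    {α : A} {d u v : T} (hd : d ≠ 0)
    (h : ∀ β, LinearMap.trace F T (doubleBracket φ α β u v) =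
      LinearMap.trace F T (doubleBracket φ α β d d)) : ∃ c : F, u = c • d := by
  have hm : (Module.finrank F T : F) ≠ 0 := by
    have : Nontrivial T := ⟨d, 0, hd⟩
    exact Nat.cast_ne_zero.2 Module.finrank_pos.ne'
  -- The trace is quadratic in β; its second difference at β, 0, -β isolates the quadratic part.
  have hq : ∀ β, φ u β * φ v β = φ d β * φ d β := by
    intro β
    have h1 := h β
    have h2 := h (-β)
    have h3 := h 0
    simp only [trace_doubleBracket, map_add, map_neg, map_zero] at h1 h2 h3
    have h4 : (2 * (Module.finrank F T : F)) * (φ u β * φ v β) =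
        (2 * (Module.finrank F T : F)) * (φ d β * φ d β) := by
      linear_combination h1 + h2 - 2 * h3
    exact mul_left_cancel₀ (mul_ne_zero two_ne_zero hm) h4
  obtain ⟨β, hβ⟩ : ∃ β, φ d β ≠ 0 := by
    by_contra! hb
    exact hd (left_nondegenerate φ (AddMonoidHom.ext hb))
  have hu : φ u β ≠ 0 := left_ne_zero_of_mul (hq β ▸ mul_ne_zero hβ hβ)
  have hv : φ v β ≠ 0 := right_ne_zero_of_mul (hq β ▸ mul_ne_zero hβ hβ)
  refine ⟨φ u β / φ d β, ?_⟩
  rw [← sub_eq_zero]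
  refine left_nondegenerate φ (AddMonoidHom.ext fun γ => ?_)
  have h1 := hq γ
  have h2 := hq (β + γ)
  simp only [map_add] at h2
  have hb := hq β
  -- Polarization of `hq`. The linear forms of u and v on `A` multiply to the square of that of d,
  -- so they must be proportional to it; `h4` is the vanishing discriminant.
  have h3 : φ u β * φ v γ + φ u γ * φ v β = 2 * (φ d β * φ d γ) := by
    linear_combination h2 - h1 - hb
  have h4 : (φ u β * φ v γ - φ u γ * φ v β) ^ 2 = 0 := by
    linear_combination (φ u β * φ v γ + φ u γ * φ v β + 2 * (φ d β * φ d γ)) * h3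
      - 4 * (φ u γ * φ v γ) * hb - 4 * (φ d β * φ d β) * h1
  have h5 : φ u β * φ v γ = φ u γ * φ v β := sub_eq_zero.1 (pow_eq_zero_iff two_ne_zero |>.1 h4)
  have h6 : φ u γ * φ v β = φ d β * φ d γ := by
    have : (2 : F) * (φ u γ * φ v β) = 2 * (φ d β * φ d γ) := by linear_combination h3 - h5
    exact mul_left_cancel₀ two_ne_zero this
  have h7 : φ u γ * φ d β = φ u β * φ d γ := by
    refine mul_left_cancel₀ hβ ?_
    linear_combination φ u β * h6 - φ u γ * hb
  rw [map_sub, map_smul, AddMonoidHom.sub_apply, AddMonoidHom.smul_apply, smul_eq_mul]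
  simp only [AddMonoidHom.zero_apply]
  field_simp
  linear_combination h7

end Scalar

end GeneralizedWitt

namespace GeneralizedWitt

/-! ### Degree-preserving automorphisms are characters -/

section Characters

variable {F A T : Type*} [Field F] [CharZero F] [AddCommGroup A] [AddCommGroup T] [Module F T]
variable (φ : T →ₗ[F] A →+ F) [LieAlgebra.IsSimple F (GeneralizedWitt φ)]
variable [Module.Finite ℤ A]

theorem moduleFinite (φ : T →ₗ[F] A →+ F) [LieAlgebra.IsSimple F (GeneralizedWitt φ)] : Module.Finite F T := by
  have := isTorsionFree_int φ
  exact Module.Finite.of_injective _ (basisEval_injective φ (Module.finBasis ℤ A))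

variable {φ} {θ : GeneralizedWitt φ ≃ₗ⁅F⁆ GeneralizedWitt φ}

theorem map_t_of_degreeEquiv (hσ : ∀ α, degreeEquiv φ θ α = α) (α : A) (d : T) :
    θ (t φ α d) = t φ α (coeffMap φ θ α d) := by
  rw [map_t, hσ]

theorem coeffMap_doubleBracket (hσ : ∀ α, degreeEquiv φ θ α = α) (α β : A) (d e : T) :
    coeffMap φ θ β (doubleBracket φ α β d d e) =
      doubleBracket φ α β (coeffMap φ θ α d) (coeffMap φ θ (-α) d) (coeffMap φ θ β e) := by
  refine t_injective φ β ?_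
  rw [← lie_lie_t, ← map_t_of_degreeEquiv hσ, ← lie_lie_t, LieEquiv.map_lie, LieEquiv.map_lie]
  simp only [map_t_of_degreeEquiv hσ]

/-- By `coeffMap_doubleBracket` the double brackets for d and for its images are conjugate, so their
traces agree and the criterion makes every vector an eigenvector. Such a linear map is scalar. -/
theorem exists_coeffMap_eq_smul (hσ : ∀ α, degreeEquiv φ θ α = α) (α : A) :
    ∃ c : F, ∀ d, coeffMap φ θ α d = c • d := by
  have := moduleFinite φ
  have hev : ∀ d, d ≠ 0 → ∃ c : F, coeffMap φ θ α d = c • d := by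
    intro d hd
    refine exists_eq_smul_of_trace_eq φ (α := α) (v := coeffMap φ θ (-α) d) hd fun β => ?_
    let g : T ≃ₗ[F] T := LinearEquiv.ofBijective (coeffMap φ θ β)
      ⟨coeffMap_injective φ θ β, coeffMap_surjective φ θ β⟩
    rw [← LinearMap.trace_conj' (doubleBracket φ α β d d) g]
    congr 1
    ext e
    obtain ⟨e, rfl⟩ := g.surjective e
    rw [LinearEquiv.conj_apply_apply, LinearEquiv.symm_apply_apply]
    exact (coeffMap_doubleBracket hσ α β d e).symm
  obtain ⟨c, hc⟩ := LinearMap.exists_eq_smul_id_of_forall_notLinearIndependent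
    (f := coeffMap φ θ α) fun d hli => by
      obtain ⟨c, hc⟩ := hev d (hli.ne_zero 0)
      rw [LinearIndependent.pair_iff] at hli
      exact one_ne_zero (neg_eq_zero.1 (hli c (-1) (by rw [hc]; module)).2)
  exact ⟨c, fun d => by rw [hc]; rfl⟩

/-- Some d separates α from β, and then [t^α d, t^β d] is a nonzero multiple of t^(α+β) d. This
fails for α = β. -/
theorem mul_eq_of_coeffMap_eq_smul (hσ : ∀ α, degreeEquiv φ θ α = α) {χ : A → F}
    (hχ : ∀ α d, coeffMap φ θ α d = χ α • d) {α β : A} (h : α ≠ β) :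
    χ (α + β) = χ α * χ β := by
  obtain ⟨d, hd⟩ : ∃ d, φ d α ≠ φ d β := by
    by_contra! h'
    exact h (eq_of_forall_apply_eq φ h')
  have hd0 : (φ d β - φ d α) • d ≠ 0 :=
    smul_ne_zero (sub_ne_zero.2 hd.symm) fun h0 => hd (by simp [h0])
  refine smul_left_injective F hd0 (t_injective φ (α + β) ?_)
  have h1 : ∀ α d, θ (t φ α d) = χ α • t φ α d := fun α d => by
    rw [map_t_of_degreeEquiv hσ, hχ, map_smul]
  have h2 : ⁅t φ α d, t φ β d⁆ = t φ (α + β) ((φ d β - φ d α) • d) := by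
    rw [lie_t_t, sub_smul]
  have h3 := θ.map_lie (t φ α d) (t φ β d)
  rw [h1, h1, smul_lie, lie_smul, h2, h1, smul_smul] at h3
  simpa only [map_smul] using h3

/-- An automorphism that preserves all degrees multiplies the homogeneous components by the values
of a character. -/
theorem exists_character (hσ : ∀ α, degreeEquiv φ θ α = α) : ∃ χ : A → F,
    (∀ α d, θ (t φ α d) = χ α • t φ α d) ∧ χ 0 = 1 ∧ ∀ α β, χ (α + β) = χ α * χ β := by
  choose χ hχ using exists_coeffMap_eq_smul hσ
  obtain ⟨d, hd⟩ := exists_ne_zero φ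
  have hd0 : d ≠ 0 := by rintro rfl; simp at hd
  have hne : ∀ α, χ α ≠ 0 := by
    intro α h
    refine hd0 (coeffMap_injective φ θ α ?_)
    rw [hχ, h, zero_smul, map_zero]
  have h0 : χ 0 = 1 := by
    have h1 := torusMap_of_degreeEquiv φ hσ d
    rw [torusMap_apply, map_t_of_degreeEquiv hσ, coeff_t_self, hχ] at h1
    exact smul_left_injective F hd0 (h1.trans (one_smul F d).symm)
  refine ⟨χ, fun α d => by rw [map_t_of_degreeEquiv hσ, hχ, map_smul], h0, fun α β => ?_⟩
  by_cases hαβ : α = β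
  swap
  · exact mul_eq_of_coeffMap_eq_smul hσ hχ hαβ
  subst hαβ
  by_cases hα : α = 0
  · subst hα; rw [add_zero, h0, mul_one]
  -- For χ(2α) = χ(α)^2, compute χ(5α) as 4 + 1 and as 3 + 2, expand using unequal summands only,
  -- and cancel χ(2α) χ(α).
  have hm : ∀ k l : ℤ, k ≠ l → χ ((k + l) • α) = χ (k • α) * χ (l • α) := by
    intro k l hkl
    rw [add_smul]
    refine mul_eq_of_coeffMap_eq_smul hσ hχ fun h => hα ?_
    refine eq_zero_of_zsmul_eq_zero φ (sub_ne_zero.2 hkl) ?_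
    rw [sub_smul, h, sub_self]
  have e3 := hm 2 1 (by norm_num)
  have e4 := hm 3 1 (by norm_num)
  have e5 := hm 4 1 (by norm_num)
  have e5' := hm 3 2 (by norm_num)
  norm_num at e3 e4 e5 e5'
  rw [← two_zsmul]
  have h2 := hne ((2 : ℤ) • α)
  have h1 := hne α
  rw [e5, e4, e3] at e5'
  refine mul_left_cancel₀ (mul_ne_zero h2 h1) ?_
  linear_combination -e5'

theorem eq_id_of_fixes_multiples (hσ : ∀ α, degreeEquiv φ θ α = α) {ι : Type*}
    (b : Module.Basis ι ℤ A) {d : T} (hd : d ≠ 0)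
    (h : ∀ i, ∃ m : ℕ, θ (t φ (m • b i) d) = t φ (m • b i) d ∧
      θ (t φ ((m + 1) • b i) d) = t φ ((m + 1) • b i) d) (x : GeneralizedWitt φ) : θ x = x := by
  obtain ⟨χ, hχ, h0, hmul⟩ := exists_character hσ
  have hfix : ∀ α, θ (t φ α d) = t φ α d → χ α = 1 := by
    intro α h
    rw [hχ, ← map_smul] at h
    exact smul_left_injective F hd ((t_injective φ α h).trans (one_smul F d).symm)
  let S : AddSubgroup A :=
    { carrier := {α | χ α = 1}
      zero_mem' := h0
      add_mem' := fun {α β} hα hβ => by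
        change χ (α + β) = 1
        rw [hmul, show χ α = 1 from hα, show χ β = 1 from hβ, one_mul]
      neg_mem' := fun {α} hα => by
        have := hmul (-α) α
        rw [neg_add_cancel, h0, show χ α = 1 from hα, mul_one] at this
        exact this.symm }
  have hb : ∀ i, b i ∈ S := by
    intro i
    obtain ⟨m, h1, h2⟩ := h i
    have h3 := hfix _ h2
    rwa [succ_nsmul, hmul, hfix _ h1, one_mul] at h3
  have hS : ∀ α, χ α = 1 := by
    intro α
    have : Submodule.span ℤ (Set.range b) ≤ AddSubgroup.toIntSubmodule S :=
      Submodule.span_le.2 (by rintro _ ⟨i, rfl⟩; exact hb i)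
    exact this (b.mem_span α)
  induction x using induction_on with
  | h0 => exact map_zero θ
  | hadd x y hx hy => rw [map_add, hx, hy]
  | ht α d => rw [hχ, hS, one_smul]

end Characters

end GeneralizedWitt

namespace GeneralizedWitt

/-! ### An element with trivial stabilizer -/

section Rigid

variable {F A T : Type*} [Field F] [AddCommGroup A] [AddCommGroup T] [Module F T]
variable (φ : T →ₗ[F] A →+ F) {n : ℕ} (b : Module.Basis (Fin n) ℤ A)

/-- Pairwise distinct integers, the multiplicities of the degrees of `rigidElement`. -/
def rigidMultiplicity (M : ℕ) (k : Fin n × Fin 2) : ℕ :=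
  M + (2 * k.1 + k.2)

theorem rigidMultiplicity_injective (M : ℕ) :
    Function.Injective (rigidMultiplicity (n := n) M) := by
  rintro ⟨i, k⟩ ⟨j, l⟩ h
  simp only [rigidMultiplicity] at h
  have := k.isLt
  have := l.isLt
  ext <;> dsimp only <;> omega

/-- The degrees of `rigidElement`. -/
noncomputable def rigidDegree (M : ℕ) (k : Fin n × Fin 2) : A :=
  rigidMultiplicity M k • b k.1

/-- An element whose stabilizer under the automorphisms of `W(A, T, φ)` is trivial. -/
noncomputable def rigidElement (M : ℕ) (d : T) : GeneralizedWitt φ :=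
  ∑ k, t φ (rigidDegree b M k) d

variable {b} in
-- Additive maps preserve divisibility, so every coordinate of the image is divisible by the
-- multiplicity of the source.
theorem rigidMultiplicity_dvd {M : ℕ} {σ : A ≃+ A} {k l : Fin n × Fin 2}
    (h : σ (rigidDegree b M k) = rigidDegree b M l) :
    rigidMultiplicity M k ∣ rigidMultiplicity M l := by
  have h1 := congrArg (fun α => b.repr α l.1) h
  simp only [rigidDegree, map_nsmul, Module.Basis.repr_self, Finsupp.smul_apply,
    Finsupp.single_eq_same, nsmul_eq_mul, mul_one] at h1
  exact Int.natCast_dvd_natCast.1 ⟨_, h1.symm⟩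

variable {b} in
theorem eq_of_map_rigidDegree {M : ℕ} {σ : A ≃+ A} {k l : Fin n × Fin 2}
    (h : σ (rigidDegree b M k) = rigidDegree b M l) : k = l :=
  rigidMultiplicity_injective M (Nat.dvd_antisymm (rigidMultiplicity_dvd h)
    (rigidMultiplicity_dvd (σ := σ.symm) (by rw [← h, AddEquiv.symm_apply_apply])))

theorem coeff_rigidElement (M : ℕ) (d : T) (k : Fin n × Fin 2) :
    coeff φ (rigidDegree b M k) (rigidElement φ b M d) = d := by
  rw [rigidElement, map_sum, Finset.sum_eq_single k, coeff_t_self]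
  · intro l _ hl
    exact coeff_t_of_ne φ (fun h => hl (eq_of_map_rigidDegree (σ := AddEquiv.refl A) h)) d
  · simp

variable {φ b} in
theorem exists_rigidDegree_eq {M : ℕ} {d : T} {α : A}
    (h : coeff φ α (rigidElement φ b M d) ≠ 0) : ∃ k, rigidDegree b M k = α := by
  contrapose! h
  rw [rigidElement, map_sum]
  exact Finset.sum_eq_zero fun k _ => coeff_t_of_ne φ (h k) d

variable [CharZero F] [LieAlgebra.IsSimple F (GeneralizedWitt φ)] [Module.Finite ℤ A]

variable {φ b} in
/-- The stabilizer of `rigidElement` is trivial. -/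
theorem eq_id_of_fixes_rigidElement {M : ℕ} (hM : 0 < M) {d : T} (hd : d ≠ 0)
    {θ : GeneralizedWitt φ ≃ₗ⁅F⁆ GeneralizedWitt φ}
    (h : θ (rigidElement φ b M d) = rigidElement φ b M d) (x : GeneralizedWitt φ) : θ x = x := by
  have h1 : ∀ k, coeff φ (degreeEquiv φ θ (rigidDegree b M k)) (rigidElement φ b M d) =
      coeffMap φ θ (rigidDegree b M k) d := by
    intro k
    conv_lhs => rw [← h]
    rw [coeff_degreeEquiv, coeff_rigidElement]
  have h2 : ∀ k, degreeEquiv φ θ (rigidDegree b M k) = rigidDegree b M k := by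
    intro k
    -- The coefficient at the image degree is nonzero, so the image is again one of the degrees of
    -- the element; distinct multiplicities leave only the same one.
    obtain ⟨l, hl⟩ := exists_rigidDegree_eq (φ := φ) (b := b) (M := M) (d := d)
      (α := degreeEquiv φ θ (rigidDegree b M k)) (by
        rw [h1]
        exact fun h0 => hd (coeffMap_injective φ θ _ (h0.trans (map_zero _).symm)))
    rw [← hl, eq_of_map_rigidDegree hl.symm]
  have h3 : ∀ i, degreeEquiv φ θ (b i) = b i := by
    intro i
    have h4 := h2 (i, 0)
    rw [rigidDegree, map_nsmul, ← sub_eq_zero, ← nsmul_sub, ← natCast_zsmul] at h4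
    refine sub_eq_zero.1 (eq_zero_of_zsmul_eq_zero φ (Nat.cast_ne_zero.2 ?_) h4)
    simp only [rigidMultiplicity]
    omega
  have hσ : ∀ α, degreeEquiv φ θ α = α := by
    have h4 : (degreeEquiv φ θ).toAddMonoidHom.toIntLinearMap = LinearMap.id := b.ext h3
    exact LinearMap.congr_fun h4
  have h5 : ∀ k, θ (t φ (rigidDegree b M k) d) = t φ (rigidDegree b M k) d := by
    intro k
    rw [map_t, ← h1, h2, coeff_rigidElement]
  exact eq_id_of_fixes_multiples hσ b hd (fun i => ⟨M + 2 * i, h5 (i, 0), h5 (i, 1)⟩) x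

end Rigid

/-! ### Separating supports by divisibility -/

section Divisors

variable {F A T : Type*} [Field F] [AddCommGroup A] [AddCommGroup T] [Module F T]
variable (φ : T →ₗ[F] A →+ F)

/-- The nonzero elements of `A` with a divisor that is at least `M`. -/
def largeDivisor (A : Type*) [AddCommGroup A] (M : ℕ) : Set A :=
  {α | α ≠ 0 ∧ ∃ m, M ≤ m ∧ ∃ β, α = m • β}

theorem map_mem_largeDivisor {M : ℕ} (σ : A ≃+ A) {α : A} (h : α ∈ largeDivisor A M) :
    σ α ∈ largeDivisor A M := by
  obtain ⟨h0, m, hm, β, rfl⟩ := h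
  exact ⟨fun h => h0 (σ.map_eq_zero_iff.1 h), m, hm, σ β, map_nsmul σ m β⟩

theorem map_mem_largeDivisor_iff {M : ℕ} (σ : A ≃+ A) {α : A} :
    σ α ∈ largeDivisor A M ↔ α ∈ largeDivisor A M :=
  ⟨fun h => by simpa using map_mem_largeDivisor σ.symm h, map_mem_largeDivisor σ⟩

theorem exists_forall_notMem_largeDivisor {ι : Type*} (b : Module.Basis ι ℤ A) (R : Finset A) :
    ∃ M, 0 < M ∧ ∀ α ∈ R, α ∉ largeDivisor A M := by
  have h : ∀ α : A, ∃ N, ∀ M, N ≤ M → α ∉ largeDivisor A M := by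
    intro α
    by_cases h0 : α = 0
    · exact ⟨0, fun M _ h => h.1 h0⟩
    obtain ⟨i, hi⟩ : ∃ i, b.repr α i ≠ 0 := by
      by_contra! h
      exact h0 (b.repr.map_eq_zero_iff.1 (Finsupp.ext h))
    -- A divisor of α divides this nonzero coordinate, so it cannot exceed its absolute value.
    refine ⟨(b.repr α i).natAbs + 1, ?_⟩
    rintro M hM ⟨-, m, hm, β, rfl⟩
    have h1 : b.repr (m • β) i = m * b.repr β i := by simp
    have h2 : m ∣ (b.repr (m • β) i).natAbs := Int.natCast_dvd.1 ⟨_, h1⟩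
    have h3 := Nat.le_of_dvd (Int.natAbs_pos.2 hi) h2
    omega
  choose N hN using h
  exact ⟨R.sup N + 1, Nat.succ_pos _, fun α hα =>
    hN α _ ((Finset.le_sup hα).trans (Nat.le_succ _))⟩

variable {φ} in
/-- All degrees that occur in `x` lie in `C`. -/
def SupportedIn (C : Set A) (x : GeneralizedWitt φ) : Prop :=
  ∀ α, coeff φ α x ≠ 0 → α ∈ C

variable {φ} in
theorem SupportedIn.eq_and_eq {C : Set A} {x x' y y' : GeneralizedWitt φ} (hx : SupportedIn Cᶜ x)
    (hx' : SupportedIn Cᶜ x') (hy : SupportedIn C y) (hy' : SupportedIn C y')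
    (h : x + y = x' + y') : x = x' ∧ y = y' := by
  have hxx : x = x' := by
    refine ext_coeff fun α => ?_
    have h1 := congrArg (coeff φ α) h
    rw [map_add, map_add] at h1
    by_cases hα : α ∈ C
    · rw [not_not.1 fun h => hx α h hα, not_not.1 fun h => hx' α h hα]
    · rwa [not_not.1 fun h => hα (hy α h), not_not.1 fun h => hα (hy' α h), add_zero,
        add_zero] at h1
  exact ⟨hxx, by rw [hxx] at h; exact add_left_cancel h⟩

variable [CharZero F] [LieAlgebra.IsSimple F (GeneralizedWitt φ)] [Module.Finite ℤ A]

variable {φ} in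
theorem SupportedIn.map {C : Set A} (hC : ∀ (σ : A ≃+ A) α, σ α ∈ C ↔ α ∈ C)
    {x : GeneralizedWitt φ} (hx : SupportedIn C x)
    (θ : GeneralizedWitt φ ≃ₗ⁅F⁆ GeneralizedWitt φ) : SupportedIn C (θ x) := by
  intro β hβ
  obtain ⟨α, rfl⟩ := (degreeEquiv φ θ).surjective β
  rw [coeff_degreeEquiv] at hβ
  exact (hC _ α).2 (hx α fun h => hβ (by rw [h, map_zero]))

variable {φ} in
theorem SupportedIn.map_local {C : Set A} (hC : ∀ (σ : A ≃+ A) α, σ α ∈ C ↔ α ∈ C)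
    {Φ : GeneralizedWitt φ →ₗ[F] GeneralizedWitt φ} (hΦ : IsLocalAutomorphism Φ)
    {x : GeneralizedWitt φ} (hx : SupportedIn C x) : SupportedIn C (Φ x) := by
  obtain ⟨θ, hθ⟩ := hΦ x
  exact hθ ▸ hx.map hC θ

variable {φ} in
/-- Let a local automorphism fix `x`, where `x` has trivial stabilizer. Then it fixes every `y` such
that the degrees of `x` and those of `y` can be separated by a characteristic subset of `A`. -/
theorem local_fixes_of_separated {C : Set A} (hC : ∀ (σ : A ≃+ A) α, σ α ∈ C ↔ α ∈ C)
    {Φ : GeneralizedWitt φ →ₗ[F] GeneralizedWitt φ} (hΦ : IsLocalAutomorphism Φ)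
    {x y : GeneralizedWitt φ} (hx : SupportedIn C x) (hy : SupportedIn Cᶜ y) (hfix : Φ x = x)
    (hrigid : ∀ θ : GeneralizedWitt φ ≃ₗ⁅F⁆ GeneralizedWitt φ, θ x = x → ∀ z, θ z = z) :
    Φ y = y := by
  have hC' : ∀ (σ : A ≃+ A) α, σ α ∈ Cᶜ ↔ α ∈ Cᶜ := fun σ α => not_congr (hC σ α)
  obtain ⟨θ, hθ⟩ := hΦ (y + x)
  rw [map_add, map_add, hfix] at hθ
  -- Both Φ and θ respect the two parts of the support, so the equation splits into Φ y = θ y and x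
  -- = θ x.
  obtain ⟨h1, h2⟩ := SupportedIn.eq_and_eq (hy.map_local hC' hΦ) (hy.map hC' θ) hx (hx.map hC θ) hθ
  rw [h1, hrigid θ h2.symm]

end Divisors

/-! ### Local and 2-local automorphisms -/

section Main

variable {F A T : Type*} [Field F] [CharZero F] [AddCommGroup A] [AddCommGroup T] [Module F T]
variable {φ : T →ₗ[F] A →+ F} [LieAlgebra.IsSimple F (GeneralizedWitt φ)]

theorem supportedIn_rigidElement {n : ℕ} (b : Module.Basis (Fin n) ℤ A) {M : ℕ} (hM : 0 < M)
    (d : T) : SupportedIn (largeDivisor A M) (rigidElement φ b M d) := by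
  intro α hα
  obtain ⟨k, rfl⟩ := exists_rigidDegree_eq hα
  refine ⟨fun h => b.ne_zero k.1 ?_, _, Nat.le_add_right _ _, _, rfl⟩
  rw [rigidDegree, ← natCast_zsmul] at h
  refine eq_zero_of_zsmul_eq_zero φ (Nat.cast_ne_zero.2 ?_) h
  simp only [rigidMultiplicity]
  omega

variable [Module.Finite ℤ A]

theorem eq_of_isLocalAutomorphism_of_fixes {n : ℕ} (b : Module.Basis (Fin n) ℤ A) {d : T}
    (hd : d ≠ 0) {Φ : GeneralizedWitt φ →ₗ[F] GeneralizedWitt φ} (hΦ : IsLocalAutomorphism Φ)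
    (hfix : Φ (rigidElement φ b 1 d) = rigidElement φ b 1 d) (y : GeneralizedWitt φ) :
    Φ y = y := by
  classical
  -- The given y may share degrees with the first rigid element. With M this large, the second one
  -- is separated from both, so fixedness passes from the first to the second and then to y.
  obtain ⟨M, hM, h⟩ := exists_forall_notMem_largeDivisor b
    (supp φ (rigidElement φ b 1 d) ∪ supp φ y)
  have hx : SupportedIn (largeDivisor A M)ᶜ (rigidElement φ b 1 d) := fun α hα =>
    h α (Finset.mem_union_left _ ((mem_supp φ).2 hα))
  have hy : SupportedIn (largeDivisor A M)ᶜ y := fun α hα =>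
    h α (Finset.mem_union_right _ ((mem_supp φ).2 hα))
  have hz := supportedIn_rigidElement (φ := φ) b hM d
  have hC : ∀ (σ : A ≃+ A) α, σ α ∈ largeDivisor A M ↔ α ∈ largeDivisor A M :=
    fun σ α => map_mem_largeDivisor_iff σ
  have hz' : SupportedIn (largeDivisor A M)ᶜᶜ (rigidElement φ b M d) := by
    rwa [compl_compl]
  have hfix' : Φ (rigidElement φ b M d) = rigidElement φ b M d :=
    local_fixes_of_separated (fun σ α => not_congr (hC σ α)) hΦ hx hz' hfix
      fun θ => eq_id_of_fixes_rigidElement one_pos hd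
  exact local_fixes_of_separated hC hΦ hz hy hfix' fun θ => eq_id_of_fixes_rigidElement hM hd

theorem isLieAutomorphism_of_isLocalAutomorphism
    {Φ : GeneralizedWitt φ →ₗ[F] GeneralizedWitt φ} (hΦ : IsLocalAutomorphism Φ) :
    IsLieAutomorphism F Φ := by
  have := isTorsionFree_int φ
  have b := Module.finBasis ℤ A
  obtain ⟨d, hd⟩ := exists_ne_zero φ
  have hd0 : d ≠ 0 := by rintro rfl; simp at hd
  obtain ⟨θ, hθ⟩ := hΦ (rigidElement φ b 1 d)
  let Ψ : GeneralizedWitt φ →ₗ[F] GeneralizedWitt φ :=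
    (θ.symm : GeneralizedWitt φ →ₗ[F] GeneralizedWitt φ) ∘ₗ Φ
  have hΨ : ∀ x, Ψ x = θ.symm (Φ x) := fun _ => rfl
  have hloc : IsLocalAutomorphism Ψ := by
    intro x
    obtain ⟨η, hη⟩ := hΦ x
    exact ⟨η.trans θ.symm, by rw [hΨ, hη, LieEquiv.trans_apply]⟩
  refine ⟨θ, fun x => ?_⟩
  have h1 := eq_of_isLocalAutomorphism_of_fixes b hd0 hloc
    (by rw [hΨ, hθ, LieEquiv.symm_apply_apply]) x
  rw [hΨ] at h1
  rw [← LieEquiv.apply_symm_apply θ (Φ x), h1]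

theorem isLieAutomorphism_of_isTwoLocalAutomorphism
    {Φ : GeneralizedWitt φ → GeneralizedWitt φ} (hΦ : IsTwoLocalAutomorphism F Φ) :
    IsLieAutomorphism F Φ := by
  have := isTorsionFree_int φ
  have b := Module.finBasis ℤ A
  obtain ⟨d, hd⟩ := exists_ne_zero φ
  have hd0 : d ≠ 0 := by rintro rfl; simp at hd
  -- Only the value at the rigid element matters; the second point 0 is arbitrary.
  obtain ⟨θ, hθ, -⟩ := hΦ (rigidElement φ b 1 d) 0
  refine ⟨θ, fun y => ?_⟩
  obtain ⟨η, hη, hy⟩ := hΦ (rigidElement φ b 1 d) y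
  have h1 := eq_id_of_fixes_rigidElement (b := b) (θ := η.trans θ.symm) one_pos hd0
    (by rw [LieEquiv.trans_apply, ← hη, hθ, LieEquiv.symm_apply_apply]) y
  rw [LieEquiv.trans_apply, ← hy] at h1
  rw [← LieEquiv.apply_symm_apply θ (Φ y), h1]

theorem exists_addEquiv_int_and_rank_le (φ : T →ₗ[F] A →+ F)
    [LieAlgebra.IsSimple F (GeneralizedWitt φ)] :
    ∃ n : ℕ, 0 < n ∧ Nonempty (A ≃+ (Fin n → ℤ)) ∧ Module.rank F T ≤ (n : Cardinal) := by
  have := isTorsionFree_int φ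
  have b := Module.finBasis ℤ A
  have := moduleFinite φ
  refine ⟨Module.finrank ℤ A, ?_, ⟨b.equivFun.toAddEquiv⟩, ?_⟩
  · rw [Nat.pos_iff_ne_zero]
    intro h
    obtain ⟨d, hd⟩ := exists_ne_zero φ
    have := Module.finrank_zero_iff.1 h
    exact hd (AddMonoidHom.ext fun α => by rw [Subsingleton.elim α 0, map_zero, map_zero])
  · rw [← Module.finrank_eq_rank, Nat.cast_le]
    have h := LinearMap.finrank_le_finrank_of_injective (basisEval_injective φ b)
    rwa [Module.finrank_fin_fun] at h

end Main

end GeneralizedWitt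

theorem mainTheorem3 {F A T : Type*} [Field F] [CharZero F] [AddCommGroup A] [AddCommGroup T]
    [Module F T] (φ : T →ₗ[F] A →+ F) [LieAlgebra.IsSimple F (GeneralizedWitt φ)]
    [AddGroup.FG A] :
    (∃ n : ℕ, 0 < n ∧ Nonempty (A ≃+ (Fin n → ℤ)) ∧ Module.rank F T ≤ (n : Cardinal)) ∧
    (∀ Φ : GeneralizedWitt φ → GeneralizedWitt φ,
      IsTwoLocalAutomorphism F Φ → IsLieAutomorphism F Φ) ∧
    (∀ Φ : GeneralizedWitt φ →ₗ[F] GeneralizedWitt φ,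
      IsLocalAutomorphism Φ → IsLieAutomorphism F Φ) := by
  have : Module.Finite ℤ A := Module.Finite.iff_addGroup_fg.2 inferInstance
  exact ⟨GeneralizedWitt.exists_addEquiv_int_and_rank_le φ,
    fun _ => GeneralizedWitt.isLieAutomorphism_of_isTwoLocalAutomorphism,
    fun _ => GeneralizedWitt.isLieAutomorphism_of_isLocalAutomorphism⟩
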